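/- All graphs are finite and simple. Let $G$ be a graph and $S\subseteq V(G)$ with $|S|\ge 2$. A \emph{pendant $S$-Steiner tree} of $G$ is a subgraph $T$ of $G$ that is a tree, satisfies $S\subseteq V(T)$, and in which every vertex of $S$ has degree $1$. Two such trees $T,T'$ are \emph{internally disjoint} if $E(T)\cap E(T')=\varnothing$ and $V(T)\cap V(T')=S$. Let $\tau_G(S)$ be the maximum number of pairwise internally disjoint pendant $S$-Steiner trees in $G$, and for $|V(G)|\ge 3$ let $$\tau_3(G)=\min\{\tau_G(S) : S\subseteq V(G),\ |S|=3\}.$$ Let $L(G)$ denote the line graph of $G$, $K_{a,b}$ the complete bipartite graph with parts of sizes $a$ and $b$, $K_n$ the complete graph of order $n$, and $\Box$ the Cartesian product of graphs. **Theorem.** For any two integers $p\ge 0$ and $q$ with $q\ge 2p$, there exists a graph $G$ such that $\tau_3(G)=p$ and $\tau_3(L(G))=q$. More precisely, $G=K_{p+2,\,q-p+2}$ has these properties, and its line graph $L(G)$ is isomorphic to $K_{p+2}\,\Box\, K_{q-p+2}$. -/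

import Mathlib

namespace PendantTree

variable {V : Type*}

/-- `T` is a pendant `S`-Steiner tree of `G`: a subgraph of `G` that is a tree, contains all
vertices of `S`, and in which every vertex of `S` has degree one. -/
structure IsPendantSteinerTree (G : SimpleGraph V) (S : Set V) (T : G.Subgraph) : Prop where
  isTree : T.coe.IsTree
  subset_verts : S ⊆ T.verts
  degree_eq_one : ∀ v ∈ S, (T.neighborSet v).encard = 1

/-- Internal disjointness of two `S`-Steiner trees: no common edge, and exactly the vertices of
`S` in common. -/
def InternallyDisjoint (G : SimpleGraph V) (S : Set V) (T T' : G.Subgraph) : Prop :=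
  T.edgeSet ∩ T'.edgeSet = ∅ ∧ T.verts ∩ T'.verts = S

/-- The pendant-tree local connectivity `τ_G(S)`: the maximum number of pairwise internally
disjoint pendant `S`-Steiner trees in `G`. -/
noncomputable def localConnectivity (G : SimpleGraph V) (S : Set V) : ℕ∞ :=
  sSup {m : ℕ∞ | ∃ F : Set G.Subgraph, (∀ T ∈ F, IsPendantSteinerTree G S T) ∧
    F.Pairwise (InternallyDisjoint G S) ∧ F.encard = m}

/-- The pendant-tree `k`-connectivity `τ_k(G)`: the minimum of `τ_G(S)` over all sets `S` of
exactly `k` vertices. It is `⊤` (so no natural number) if `G` has fewer than `k` vertices. -/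
noncomputable def connectivity (k : ℕ) (G : SimpleGraph V) : ℕ∞ :=
  sInf {m : ℕ∞ | ∃ S : Set V, S.encard = k ∧ localConnectivity G S = m}

end PendantTree

/-! For three terminals, no edge of a pendant tree joins two of them, so internally disjoint trees
leave a terminal `x` through distinct neighbours outside `S`; hence τ(S) ≤ |N(x) \ S|. Choosing `x`
of minimum degree and two of its neighbours as `S` gives p for the bipartite graph and p + (q - p) =
q for the product. Lower bounds come from disjoint connectors (`IsConnector`,
`le_localConnectivity`). In the bipartite graph, a fresh vertex of each part gives a connector: one
of the two alone, or the edge between them. In the product, every row or column avoiding the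
terminals gives one; if the terminals span r rows and s columns, the spanned r × s grid supplies the
missing r + s - 4. -/

namespace PendantTree

/-! ### Bounds on local connectivity in an arbitrary graph. -/

variable {V : Type*} {G : SimpleGraph V}

/-- No edge of a pendant Steiner tree joins two terminals, provided there is a third terminal. -/
theorem IsPendantSteinerTree.notMem_of_adj {S : Set V} {T : G.Subgraph}
    (hT : IsPendantSteinerTree G S T) (hS : 2 < S.encard) {u v : V} (hu : u ∈ S)
    (huv : T.Adj u v) : v ∉ S := by
  intro hv
  obtain ⟨a, ha⟩ := Set.encard_eq_one.1 (hT.degree_eq_one u hu)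
  obtain ⟨b, hb⟩ := Set.encard_eq_one.1 (hT.degree_eq_one v hv)
  have hu' : ∀ w, T.Adj u w → w = v := by
    intro w hw
    have h1 : w ∈ T.neighborSet u := hw
    have h2 : v ∈ T.neighborSet u := huv
    rw [ha] at h1 h2
    exact h1.trans h2.symm
  have hv' : ∀ w, T.Adj v w → w = u := by
    intro w hw
    have h1 : w ∈ T.neighborSet v := hw
    have h2 : u ∈ T.neighborSet v := huv.symm
    rw [hb] at h1 h2
    exact h1.trans h2.symm
  -- Two adjacent vertices of degree one form a whole component, so connectedness leaves no room for
  -- a third terminal.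
  have closed : ∀ c d : T.verts, T.coe.Walk c d → ((c : V) = u ∨ (c : V) = v) →
      ((d : V) = u ∨ (d : V) = v) := by
    intro c d p
    induction p with
    | nil => exact id
    | cons h p ih =>
      rintro (hc | hc)
      · refine ih (.inr (hu' _ ?_))
        rw [← hc]; exact h
      · refine ih (.inl (hv' _ ?_))
        rw [← hc]; exact h
  have hsub : S ⊆ {u, v} := fun s hs => by
    obtain ⟨p⟩ := hT.isTree.connected.preconnected ⟨u, hT.subset_verts hu⟩
      ⟨s, hT.subset_verts hs⟩
    exact closed _ _ p (.inl rfl)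
  refine absurd ((Set.encard_le_encard hsub).trans ?_) (not_le.2 hS)
  grw [Set.encard_insert_le, Set.encard_singleton]
  norm_num

/-- Pendant Steiner trees sharing only their terminals are internally disjoint. -/
theorem IsPendantSteinerTree.internallyDisjoint {S : Set V} {T T' : G.Subgraph}
    (hT : IsPendantSteinerTree G S T) (hS : 2 < S.encard)
    (h : T.verts ∩ T'.verts = S) : InternallyDisjoint G S T T' := by
  refine ⟨?_, h⟩
  rw [Set.eq_empty_iff_forall_notMem]
  intro e
  induction e with
  | h u v =>
    rintro ⟨h1, h2⟩
    rw [SimpleGraph.Subgraph.mem_edgeSet] at h1 h2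
    have hu : u ∈ S := h ▸ ⟨h1.fst_mem, h2.fst_mem⟩
    have hv : v ∈ S := h ▸ ⟨h1.snd_mem, h2.snd_mem⟩
    exact hT.notMem_of_adj hS hu h1 hv

/-- The edges at a terminal of internally disjoint trees lead to distinct non-terminals. -/
theorem localConnectivity_le_encard_neighborSet_diff {S : Set V} (hS : 2 < S.encard) {x : V}
    (hx : x ∈ S) : localConnectivity G S ≤ (G.neighborSet x \ S).encard := by
  refine sSup_le ?_
  rintro _ ⟨F, hF, hdis, rfl⟩
  have hex : ∀ T ∈ F, ∃ v, T.Adj x v := fun T hT => by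
    obtain ⟨a, ha⟩ := Set.encard_eq_one.1 ((hF T hT).degree_eq_one x hx)
    exact ⟨a, show a ∈ T.neighborSet x from ha ▸ rfl⟩
  have : Nonempty V := ⟨x⟩
  choose! f hf using hex
  refine Set.encard_le_encard_of_injOn (f := f) (fun T hT => ⟨(hf T hT).adj_sub,
    (hF T hT).notMem_of_adj hS hx (hf T hT)⟩) ?_
  intro T hT T' hT' heq
  by_contra hne
  have hmem : s(x, f T) ∈ T.edgeSet ∩ T'.edgeSet := ⟨hf T hT, heq ▸ hf T' hT'⟩
  rw [(hdis hT hT' hne).1] at hmem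
  exact hmem

/-- Attaching a new vertex to a subgraph by a single edge preserves connectedness. -/
theorem connected_sup_subgraphOfAdj {T : G.Subgraph} (hT : T.Connected) {u v : V}
    (h : G.Adj u v) (hu : u ∈ T.verts) : (T ⊔ G.subgraphOfAdj h).Connected :=
  SimpleGraph.Subgraph.connected_sup hT.preconnected
    (SimpleGraph.Subgraph.subgraphOfAdj_connected h).preconnected ⟨u, hu, by simp⟩

/-- Attaching a new vertex to a subgraph by a single edge creates no cycle. -/
theorem isAcyclic_sup_subgraphOfAdj {T : G.Subgraph} (hT : T.spanningCoe.IsAcyclic) {u v : V}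
    (h : G.Adj u v) (hv : v ∉ T.verts) : (T ⊔ G.subgraphOfAdj h).spanningCoe.IsAcyclic := by
  -- The new vertex is isolated in `T.spanningCoe`.
  have hnr : ¬ T.spanningCoe.Reachable v u := by
    rintro ⟨p⟩
    cases p with
    | nil => exact h.ne rfl
    | cons hadj p => exact hv (SimpleGraph.Subgraph.Adj.fst_mem hadj)
  refine (hT.sup_edge_of_not_reachable hnr).anti fun w w' hw => ?_
  simp only [SimpleGraph.Subgraph.spanningCoe_adj, SimpleGraph.Subgraph.sup_adj,
    SimpleGraph.subgraphOfAdj_adj, SimpleGraph.sup_adj, SimpleGraph.edge_adj] at hw ⊢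
  refine hw.imp_right fun hw => ?_
  rw [Sym2.eq_iff] at hw
  have := h.ne
  grind

theorem isTree_coe_of_connected_of_isAcyclic {T : G.Subgraph} (hT : T.Connected)
    (hT' : T.spanningCoe.IsAcyclic) : T.coe.IsTree :=
  ⟨hT.coe, hT'.comap ⟨Subtype.val, fun h => h⟩ Subtype.val_injective⟩

/-- Allowing `u = v`, or `v` already in `W`, lets connectors with coinciding vertices be treated
uniformly. -/
theorem exists_connected_isAcyclic_insert {W : Set V}
    (hW : ∃ T : G.Subgraph, T.Connected ∧ T.spanningCoe.IsAcyclic ∧ T.verts = W)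
    {u v : V} (hu : u ∈ W) (huv : u = v ∨ G.Adj u v) :
    ∃ T : G.Subgraph, T.Connected ∧ T.spanningCoe.IsAcyclic ∧ T.verts = insert v W := by
  by_cases hv : v ∈ W
  · rwa [Set.insert_eq_of_mem hv]
  obtain ⟨T, hT, hT', rfl⟩ := hW
  have h : G.Adj u v := huv.resolve_left (by rintro rfl; exact hv hu)
  refine ⟨_, connected_sup_subgraphOfAdj hT h hu, isAcyclic_sup_subgraphOfAdj hT' h hv, ?_⟩
  ext w
  simp only [SimpleGraph.Subgraph.verts_sup, SimpleGraph.subgraphOfAdj_verts, Set.mem_union,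
    Set.mem_insert_iff, Set.mem_singleton_iff]
  grind

/-- Three non-terminals, consecutively equal or adjacent, each attached to one of three terminals. -/
structure IsConnector (G : SimpleGraph V) (x y z a b c : V) : Prop where
  adj_x : G.Adj x a
  adj_y : G.Adj y b
  adj_z : G.Adj z c
  ab : a = b ∨ G.Adj a b
  bc : b = c ∨ G.Adj b c
  disj : Disjoint ({a, b, c} : Set V) {x, y, z}

/-- A tree on the connector vertices is grown first; the terminals lie outside it and are then hung
on as leaves, hence have degree one. -/
theorem IsConnector.exists_tree {x y z a b c : V} (h : IsConnector G x y z a b c)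
    (hxy : x ≠ y) (hxz : x ≠ z) (hyz : y ≠ z) :
    ∃ T : G.Subgraph, IsPendantSteinerTree G {x, y, z} T ∧
      T.verts = {a, b, c} ∪ {x, y, z} := by
  obtain ⟨T, hT, hT', hv⟩ : ∃ T : G.Subgraph, T.Connected ∧ T.spanningCoe.IsAcyclic ∧
      T.verts = {c, b, a} := by
    refine exists_connected_isAcyclic_insert (exists_connected_isAcyclic_insert
      ⟨G.singletonSubgraph a, SimpleGraph.Subgraph.singletonSubgraph_connected, ?_, rfl⟩
      rfl h.ab) (by simp) h.bc
    exact SimpleGraph.isAcyclic_bot.anti fun u v huv => huv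
  have hd := Set.disjoint_left.1 h.disj
  simp only [Set.mem_insert_iff, Set.mem_singleton_iff] at hd
  have hx : x ∉ T.verts := by rw [hv]; simp; grind
  have hy : y ∉ T.verts := by rw [hv]; simp; grind
  have hz : z ∉ T.verts := by rw [hv]; simp; grind
  have c1 := connected_sup_subgraphOfAdj hT h.adj_x.symm (by simp [hv])
  have a1 := isAcyclic_sup_subgraphOfAdj hT' h.adj_x.symm hx
  have c2 := connected_sup_subgraphOfAdj c1 h.adj_y.symm (by simp [hv])
  have a2 := isAcyclic_sup_subgraphOfAdj a1 h.adj_y.symm (by simp; grind)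
  have c3 := connected_sup_subgraphOfAdj c2 h.adj_z.symm (by simp [hv])
  have a3 := isAcyclic_sup_subgraphOfAdj a2 h.adj_z.symm (by simp; grind)
  refine ⟨_, ⟨isTree_coe_of_connected_of_isAcyclic c3 a3, ?_, ?_⟩, ?_⟩
  · intro w; simp; grind
  · have hn : ∀ s, s ∉ T.verts → ∀ w, ¬ T.Adj s w := fun s hs w hw => hs hw.fst_mem
    simp only [Set.mem_insert_iff, Set.mem_singleton_iff, forall_eq_or_imp, forall_eq]
    refine ⟨Set.encard_eq_one.2 ⟨a, ?_⟩, Set.encard_eq_one.2 ⟨b, ?_⟩,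
      Set.encard_eq_one.2 ⟨c, ?_⟩⟩ <;> ext w <;> simp [hn _ hx, hn _ hy, hn _ hz] <;> grind
  · ext w; simp [hv]; grind

theorem le_localConnectivity {x y z : V} (hxy : x ≠ y) (hxz : x ≠ z) (hyz : y ≠ z)
    {ι : Type*} (a b c : ι → V) (h : ∀ i, IsConnector G x y z (a i) (b i) (c i))
    (hdis : Pairwise fun i j => Disjoint ({a i, b i, c i} : Set V) {a j, b j, c j}) :
    ENat.card ι ≤ localConnectivity G {x, y, z} := by
  choose T hT hv using fun i => (h i).exists_tree hxy hxz hyz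
  have hinter : ∀ i j, i ≠ j → (T i).verts ∩ (T j).verts = {x, y, z} := fun i j hij => by
    rw [hv, hv, ← Set.inter_union_distrib_right, (hdis hij).inter_eq, Set.empty_union]
  -- If two indices gave the same tree, its vertex set would be the terminals alone, yet it contains
  -- `a i`.
  have hinj : Function.Injective T := fun i j hij => by
    by_contra hne
    have h1 := hinter i j hne
    rw [← hij, Set.inter_self] at h1
    have h2 : a i ∈ (T i).verts := by simp [hv]
    rw [h1] at h2
    exact Set.disjoint_left.1 (h i).disj (by simp) h2
  have hS : (2 : ℕ∞) < ({x, y, z} : Set V).encard := by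
    rw [Set.encard_eq_three.2 ⟨x, y, z, hxy, hxz, hyz, rfl⟩]; norm_num
  refine hinj.encard_range.trans (le_sSup ⟨Set.range T, ?_, ?_, rfl⟩)
  · rintro _ ⟨i, rfl⟩; exact hT i
  · rintro _ ⟨i, rfl⟩ _ ⟨j, rfl⟩ hne
    exact (hT i).internallyDisjoint hS (hinter i j fun hij => hne (hij ▸ rfl))

end PendantTree

/-! ### Complete bipartite graphs. -/

namespace PendantTree

variable {V V' : Type*} {G : SimpleGraph V} {G' : SimpleGraph V'}

theorem IsConnector.map (e : G ≃g G') {x y z a b c : V} (h : IsConnector G x y z a b c) :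
    IsConnector G' (e x) (e y) (e z) (e a) (e b) (e c) where
  adj_x := e.map_adj_iff.2 h.adj_x
  adj_y := e.map_adj_iff.2 h.adj_y
  adj_z := e.map_adj_iff.2 h.adj_z
  ab := h.ab.imp (congrArg e) e.map_adj_iff.2
  bc := h.bc.imp (congrArg e) e.map_adj_iff.2
  disj := by
    have := (Set.disjoint_image_iff e.injective).2 h.disj
    simpa only [Set.image_insert_eq, Set.image_singleton] using this

theorem encard_neighborSet_diff_image (e : G ≃g G') (x : V) (S : Set V) :
    (G'.neighborSet (e x) \ e '' S).encard = (G.neighborSet x \ S).encard := by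
  rw [← e.injective.injOn.encard_image (s := G.neighborSet x \ S),
    Set.image_sdiff e.injective]
  congr 2
  ext v
  obtain ⟨w, rfl⟩ := e.surjective v
  simpa using e.map_adj_iff

theorem exists_injective_notMem {α : Type*} [Fintype α] [DecidableEq α] (A : Finset α) {p : ℕ}
    (h : p + A.card ≤ Fintype.card α) :
    ∃ f : Fin p → α, Function.Injective f ∧ ∀ k, f k ∉ A := by
  have : Fintype.card (Fin p) ≤ Fintype.card {i // i ∉ A} := by
    rw [Fintype.card_fin, Fintype.card_subtype_compl, Fintype.card_coe]
    omega
  obtain ⟨f⟩ := Function.Embedding.nonempty_of_card_le this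
  exact ⟨fun k => f k, Subtype.val_injective.comp f.injective, fun k => (f k).2⟩

/-- In a complete bipartite graph any three vertices have as many disjoint connectors as both parts
have vertices beyond two. -/
theorem exists_connectors_completeBipartiteGraph {α β : Type*} [Fintype α] [Fintype β]
    [DecidableEq α] [DecidableEq β] {p : ℕ} (hα : p + 2 ≤ Fintype.card α)
    (hβ : p + 2 ≤ Fintype.card β) (x y z : α ⊕ β) :
    ∃ a b c : Fin p → α ⊕ β,
      (∀ i, IsConnector (completeBipartiteGraph α β) x y z (a i) (b i) (c i)) ∧
      Pairwise fun i j => Disjoint ({a i, b i, c i} : Set (α ⊕ β)) {a j, b j, c j} := by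
  -- Each terminal is attached to whichever of `u`, `v` lies in the opposite part. `A` and `B` hold
  -- the terminals to avoid; when all three lie in one part, only the opposite vertex is used and
  -- nothing need be avoided, so two exclusions per part always suffice.
  have key (A : Finset α) (B : Finset β) (hA : A.card ≤ 2) (hB : B.card ≤ 2)
      (h : ∀ u ∉ A, ∀ v ∉ B, IsConnector (completeBipartiteGraph α β) x y z
        (Sum.elim (fun _ => .inr v) (fun _ => .inl u) x)
        (Sum.elim (fun _ => .inr v) (fun _ => .inl u) y)
        (Sum.elim (fun _ => .inr v) (fun _ => .inl u) z)) :
      ∃ a b c : Fin p → α ⊕ β,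
      (∀ i, IsConnector (completeBipartiteGraph α β) x y z (a i) (b i) (c i)) ∧
      Pairwise fun i j => Disjoint ({a i, b i, c i} : Set (α ⊕ β)) {a j, b j, c j} := by
    obtain ⟨f, hf, hfA⟩ := exists_injective_notMem (p := p) A (by omega)
    obtain ⟨g, hg, hgB⟩ := exists_injective_notMem (p := p) B (by omega)
    refine ⟨_, _, _, fun k => h (f k) (hfA k) (g k) (hgB k), fun i j hij => ?_⟩
    have h1 := hf.ne hij
    have h2 := hg.ne hij
    rcases x with x | x <;> rcases y with y | y <;> rcases z with z | z <;> simp <;> grind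
  rcases x with x | x <;> rcases y with y | y <;> rcases z with z | z
  · exact key ∅ ∅ (by simp) (by simp) fun u _ v _ => by constructor <;> simp
  · exact key {x, y} {z} Finset.card_le_two (by simp) fun u hu v hv => by
      constructor <;> simp at hu hv ⊢; grind
  · exact key {x, z} {y} Finset.card_le_two (by simp) fun u hu v hv => by
      constructor <;> simp at hu hv ⊢; grind
  · exact key {x} {y, z} (by simp) Finset.card_le_two fun u hu v hv => by
      constructor <;> simp at hu hv ⊢; grind
  · exact key {y, z} {x} Finset.card_le_two (by simp) fun u hu v hv => by
      constructor <;> simp at hu hv ⊢; grind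
  · exact key {y} {x, z} (by simp) Finset.card_le_two fun u hu v hv => by
      constructor <;> simp at hu hv ⊢; grind
  · exact key {z} {x, y} (by simp) Finset.card_le_two fun u hu v hv => by
      constructor <;> simp at hu hv ⊢; grind
  · exact key ∅ ∅ (by simp) (by simp) fun u _ v _ => by constructor <;> simp

theorem connectivity_three_completeBipartiteGraph {m n : ℕ} (hmn : m ≤ n) :
    connectivity 3 (completeBipartiteGraph (Fin (m + 2)) (Fin (n + 2))) = m := by
  apply le_antisymm
  -- A vertex of the larger part has only m + 2 neighbours, two of which are made terminals.
  · have hS : ({.inr 0, .inl 0, .inl 1} : Set (Fin (m + 2) ⊕ Fin (n + 2))).encard = 3 :=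
      Set.encard_eq_three.2 ⟨_, _, _, by simp, by simp, by simp, rfl⟩
    refine le_trans (sInf_le ⟨_, hS, rfl⟩) <|
      (localConnectivity_le_encard_neighborSet_diff (x := Sum.inr 0) (by rw [hS]; norm_num)
        (by simp)).trans ?_
    have hsub : ((completeBipartiteGraph (Fin (m + 2)) (Fin (n + 2))).neighborSet (.inr 0) \
        {.inr 0, .inl 0, .inl 1}) ⊆
        Sum.inl '' ((({0, 1} : Finset (Fin (m + 2)))ᶜ : Finset _) : Set (Fin (m + 2))) := by
      rintro (v | v) <;> simp; grind
    grw [hsub, Set.encard_image_le, Set.encard_coe_eq_coe_finsetCard, Finset.card_compl]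
    simp
  · refine le_sInf ?_
    rintro _ ⟨S, hS, rfl⟩
    obtain ⟨x, y, z, hxy, hxz, hyz, rfl⟩ := Set.encard_eq_three.1 hS
    obtain ⟨a, b, c, h, hd⟩ := exists_connectors_completeBipartiteGraph (p := m)
      (by simp) (by simpa using hmn) x y z
    simpa using le_localConnectivity hxy hxz hyz a b c h hd

end PendantTree

/-! ### Products of complete graphs, and the line graph. -/

namespace PendantTree

variable {α β : Type*}

open SimpleGraph

theorem boxProd_top_adj {x y : α × β} :
    ((⊤ : SimpleGraph α).boxProd (⊤ : SimpleGraph β)).Adj x y ↔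
      (x.1 ≠ y.1 ∧ x.2 = y.2) ∨ (x.2 ≠ y.2 ∧ x.1 = y.1) := by
  simp [boxProd_adj]

theorem card_insert_insert_singleton_le_two {γ : Type*} [DecidableEq γ] {u v w : γ}
    (h : u = v ∨ u = w ∨ v = w) : ({u, v, w} : Finset γ).card ≤ 2 := by
  rcases h with rfl | rfl | rfl <;> simp [Finset.card_le_two]

/-- Connectors inside the grid spanned by the coordinates of the three terminals. -/
theorem exists_connectors_in_span [DecidableEq α] [DecidableEq β] {x y z : α × β}
    (hxy : x ≠ y) (hxz : x ≠ z) (hyz : y ≠ z) :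
    ∃ (k : ℕ) (a b c : Fin k → α × β),
      ({x.1, y.1, z.1} : Finset α).card + ({x.2, y.2, z.2} : Finset β).card ≤ k + 4 ∧
      (∀ i, IsConnector ((⊤ : SimpleGraph α).boxProd (⊤ : SimpleGraph β)) x y z
        (a i) (b i) (c i)) ∧
      (Pairwise fun i j => Disjoint ({a i, b i, c i} : Set (α × β)) {a j, b j, c j}) ∧
      ∀ i, ∀ v ∈ ({a i, b i, c i} : Set (α × β)),
        v.1 ∈ ({x.1, y.1, z.1} : Finset α) ∧ v.2 ∈ ({x.2, y.2, z.2} : Finset β) := by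
  obtain ⟨x₁, x₂⟩ := x
  obtain ⟨y₁, y₂⟩ := y
  obtain ⟨z₁, z₂⟩ := z
  simp only [ne_eq, Prod.mk.injEq, not_and] at hxy hxz hyz
  dsimp only
  have h3α : ({x₁, y₁, z₁} : Finset α).card ≤ 3 := Finset.card_le_three
  have h3β : ({x₂, y₂, z₂} : Finset β).card ≤ 3 := Finset.card_le_three
  by_cases hcard : ({x₁, y₁, z₁} : Finset α).card + ({x₂, y₂, z₂} : Finset β).card ≤ 4
  · exact ⟨0, Fin.elim0, Fin.elim0, Fin.elim0, hcard, fun i => i.elim0,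
      fun i => i.elim0, fun i => i.elim0⟩
  by_cases hα : x₁ ≠ y₁ ∧ x₁ ≠ z₁ ∧ y₁ ≠ z₁
  · by_cases hβ : x₂ ≠ y₂ ∧ x₂ ≠ z₂ ∧ y₂ ≠ z₂
    -- With the terminals on the diagonal of a 3 × 3 grid, the two connectors are the rest of the
    -- row and the rest of the column of `x`.
    · refine ⟨2, ![(x₁, y₂), (y₁, x₂)], ![(x₁, y₂), (y₁, x₂)], ![(x₁, z₂), (z₁, x₂)], by omega,
        ?_, ?_, ?_⟩
      · rw [Fin.forall_fin_two]
        constructor <;> constructor <;> simp <;> grind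
      · intro i j
        fin_cases i <;> fin_cases j <;> simp <;> grind
      · rw [Fin.forall_fin_two]
        simp
    · have h2 : ({x₂, y₂, z₂} : Finset β).card ≤ 2 :=
      card_insert_insert_singleton_le_two (by grind)
      suffices ∃ u, u ∈ ({x₁, y₁, z₁} : Finset α) ∧ ∃ v, v ∈ ({x₂, y₂, z₂} : Finset β) ∧
          IsConnector ((⊤ : SimpleGraph α).boxProd (⊤ : SimpleGraph β))
            (x₁, x₂) (y₁, y₂) (z₁, z₂) (u, v) (u, v) (u, v) by
        obtain ⟨u, hu, v, hv, h⟩ := this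
        exact ⟨1, fun _ => (u, v), fun _ => (u, v), fun _ => (u, v), by omega, fun _ => h,
          fun i j hij => absurd (Subsingleton.elim i j) hij, fun i w hw => by simp at hw; grind⟩
      have hne : ¬ (x₂ = y₂ ∧ x₂ = z₂) := by
        rintro ⟨rfl, rfl⟩
        simp at hcard; omega
      -- Two terminals share a second coordinate; the cell with that coordinate and the first
      -- coordinate of the remaining terminal is adjacent to all three.
      obtain h | h | h : x₂ = y₂ ∨ x₂ = z₂ ∨ y₂ = z₂ := by grind
      · refine ⟨z₁, by simp, x₂, by simp, ?_⟩
        constructor <;> simp <;> grind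
      · refine ⟨y₁, by simp, x₂, by simp, ?_⟩
        constructor <;> simp <;> grind
      · refine ⟨x₁, by simp, y₂, by simp, ?_⟩
        constructor <;> simp <;> grind
  · have h2 : ({x₁, y₁, z₁} : Finset α).card ≤ 2 :=
      card_insert_insert_singleton_le_two (by grind)
    suffices ∃ u, u ∈ ({x₁, y₁, z₁} : Finset α) ∧ ∃ v, v ∈ ({x₂, y₂, z₂} : Finset β) ∧
        IsConnector ((⊤ : SimpleGraph α).boxProd (⊤ : SimpleGraph β))
          (x₁, x₂) (y₁, y₂) (z₁, z₂) (u, v) (u, v) (u, v) by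
      obtain ⟨u, hu, v, hv, h⟩ := this
      exact ⟨1, fun _ => (u, v), fun _ => (u, v), fun _ => (u, v), by omega, fun _ => h,
        fun i j hij => absurd (Subsingleton.elim i j) hij, fun i w hw => by simp at hw; grind⟩
    have hne : ¬ (x₁ = y₁ ∧ x₁ = z₁) := by
      rintro ⟨rfl, rfl⟩
      simp at hcard; omega
    have hβ : x₂ ≠ y₂ ∧ x₂ ≠ z₂ ∧ y₂ ≠ z₂ := by
      by_contra hβ
      have : ({x₂, y₂, z₂} : Finset β).card ≤ 2 :=
        card_insert_insert_singleton_le_two (by grind)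
      omega
    obtain h | h | h : x₁ = y₁ ∨ x₁ = z₁ ∨ y₁ = z₁ := by grind
    · refine ⟨x₁, by simp, z₂, by simp, ?_⟩
      constructor <;> simp <;> grind
    · refine ⟨x₁, by simp, y₂, by simp, ?_⟩
      constructor <;> simp <;> grind
    · refine ⟨y₁, by simp, x₂, by simp, ?_⟩
      constructor <;> simp <;> grind

/-- Besides the connectors in the spanned grid there is one in every further row and column. -/
theorem exists_connectors_boxProd_top [Fintype α] [Fintype β] [DecidableEq α] [DecidableEq β]
    {x y z : α × β} (hxy : x ≠ y) (hxz : x ≠ z) (hyz : y ≠ z) :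
    ∃ (k : ℕ) (a b c : Fin k → α × β), Fintype.card α + Fintype.card β ≤ k + 4 ∧
      (∀ i, IsConnector ((⊤ : SimpleGraph α).boxProd (⊤ : SimpleGraph β)) x y z
        (a i) (b i) (c i)) ∧
      (Pairwise fun i j => Disjoint ({a i, b i, c i} : Set (α × β)) {a j, b j, c j}) := by
  obtain ⟨k, a, b, c, hcard, h, hdis, hmem⟩ := exists_connectors_in_span hxy hxz hyz
  set R : Finset α := {x.1, y.1, z.1} with hR
  set C : Finset β := {x.2, y.2, z.2} with hC
  let ι := {i // i ∉ R} ⊕ {j // j ∉ C} ⊕ Fin k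
  have hι : Fintype.card α + Fintype.card β ≤ Fintype.card ι + 4 := by
    simp only [ι, Fintype.card_sum, Fintype.card_subtype_compl, Fintype.card_coe,
      Fintype.card_fin]
    omega
  let f (v : α × β) (w : Fin k → α × β) : ι → α × β :=
    Sum.elim (fun i => (i, v.2)) (Sum.elim (fun j => (v.1, j)) w)
  let e : Fin (Fintype.card ι) ≃ ι := (Fintype.equivFin ι).symm
  have hcon : ∀ i, IsConnector ((⊤ : SimpleGraph α).boxProd (⊤ : SimpleGraph β)) x y z
      (f x a i) (f y b i) (f z c i) := by
    rintro (⟨i, hi⟩ | ⟨j, hj⟩ | i)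
    · simp only [hR, Finset.mem_insert, Finset.mem_singleton, not_or] at hi
      constructor <;> simp [f] <;> grind
    · simp only [hC, Finset.mem_insert, Finset.mem_singleton, not_or] at hj
      constructor <;> simp [f] <;> grind
    · exact h i
  have hd : Pairwise fun i j =>
      Disjoint ({f x a i, f y b i, f z c i} : Set (α × β)) {f x a j, f y b j, f z c j} := by
    -- A connector in a new row has first coordinate outside `R` and second in `C`, one in a new
    -- column the reverse, and one in the grid has both inside, so different kinds never meet.
    have hxR : x.1 ∈ R ∧ y.1 ∈ R ∧ z.1 ∈ R := by simp [hR]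
    have hxC : x.2 ∈ C ∧ y.2 ∈ C ∧ z.2 ∈ C := by simp [hC]
    simp only [Set.mem_insert_iff, Set.mem_singleton_iff, forall_eq_or_imp, forall_eq] at hmem
    clear_value R C
    rintro (⟨i, hi⟩ | ⟨j, hj⟩ | i) (⟨i', hi'⟩ | ⟨j', hj'⟩ | i') hne
    on_goal 9 => exact hdis fun hii => hne (by rw [hii])
    all_goals simp [f] at hne ⊢; grind
  exact ⟨Fintype.card ι, f x a ∘ e, f y b ∘ e, f z c ∘ e, hι, fun i => hcon (e i),
    fun i j hij => hd (e.injective.ne hij)⟩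

/-- Stated up to isomorphism so that it applies to the line graph, whose vertices are edges without
explicit coordinates. -/
theorem connectivity_three_of_iso_boxProd_top {V : Type*} {G : SimpleGraph V} {m n : ℕ}
    (e : (⊤ : SimpleGraph (Fin (m + 2))).boxProd (⊤ : SimpleGraph (Fin (n + 2))) ≃g G) :
    connectivity 3 G = (m + n : ℕ) := by
  apply le_antisymm
  -- The corner has m + n + 2 neighbours; one in each direction becomes a terminal.
  · let S : Set (Fin (m + 2) × Fin (n + 2)) := {(0, 0), (0, 1), (1, 0)}
    have hS : (e '' S).encard = 3 := by
      rw [e.injective.injOn.encard_image]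
      exact Set.encard_eq_three.2 ⟨_, _, _, by simp, by simp, by simp, rfl⟩
    refine le_trans (sInf_le ⟨_, hS, rfl⟩) <|
      (localConnectivity_le_encard_neighborSet_diff (x := e (0, 0)) (by rw [hS]; norm_num)
        (Set.mem_image_of_mem _ (by simp [S]))).trans ?_
    rw [encard_neighborSet_diff_image]
    have hsub : (((⊤ : SimpleGraph (Fin (m + 2))).boxProd
        (⊤ : SimpleGraph (Fin (n + 2)))).neighborSet (0, 0) \ S) ⊆
        (fun i => (i, 0)) '' ((({0, 1} : Finset (Fin (m + 2)))ᶜ : Finset _) : Set _) ∪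
        (fun j => (0, j)) '' ((({0, 1} : Finset (Fin (n + 2)))ᶜ : Finset _) : Set _) := by
      rintro ⟨i, j⟩ hij
      simp [S] at hij ⊢
      grind
    grw [hsub, Set.encard_union_le, Set.encard_image_le, Set.encard_image_le,
      Set.encard_coe_eq_coe_finsetCard, Set.encard_coe_eq_coe_finsetCard, Finset.card_compl,
      Finset.card_compl]
    simp
  · refine le_sInf ?_
    rintro _ ⟨S, hS, rfl⟩
    obtain ⟨x, y, z, hxy, hxz, hyz, rfl⟩ := Set.encard_eq_three.1 hS
    obtain ⟨x, rfl⟩ := e.surjective x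
    obtain ⟨y, rfl⟩ := e.surjective y
    obtain ⟨z, rfl⟩ := e.surjective z
    obtain ⟨k, a, b, c, hk, h, hd⟩ := exists_connectors_boxProd_top
      (fun h => hxy (congrArg e h)) (fun h => hxz (congrArg e h)) (fun h => hyz (congrArg e h))
    have hle := le_localConnectivity hxy hxz hyz (e ∘ a) (e ∘ b) (e ∘ c) (fun i => (h i).map e)
      fun i j hij => by
        have := (Set.disjoint_image_iff e.injective).2 (hd hij)
        simpa only [Set.image_insert_eq, Set.image_singleton, Function.comp_apply] using this
    refine le_trans ?_ hle
    simp only [Fintype.card_fin] at hk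
    simp only [ENat.card_eq_coe_fintype_card, Fintype.card_fin, Nat.cast_le]
    omega

/-- An edge of a complete bipartite graph is a pair of vertices, one from each part. -/
theorem nonempty_iso_lineGraph_completeBipartiteGraph (α β : Type*) :
    Nonempty ((⊤ : SimpleGraph α).boxProd (⊤ : SimpleGraph β) ≃g
      (completeBipartiteGraph α β).lineGraph) := by
  let f : α × β → (completeBipartiteGraph α β).edgeSet :=
    fun v => ⟨s(.inl v.1, .inr v.2), by simp⟩
  have hf : Function.Bijective f := by
    constructor
    · rintro ⟨a, b⟩ ⟨a', b'⟩ h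
      simpa [f] using h
    · rintro ⟨e, he⟩
      induction e with
      | h u v =>
        rcases u with u | u <;> rcases v with v | v <;> simp at he
        · exact ⟨(u, v), rfl⟩
        · exact ⟨(v, u), Subtype.ext Sym2.eq_swap⟩
  refine ⟨⟨Equiv.ofBijective f hf, ?_⟩⟩
  rintro ⟨a, b⟩ ⟨a', b'⟩
  simp only [Equiv.ofBijective_apply, SimpleGraph.lineGraph_adj_iff_exists, hf.injective.ne_iff,
    boxProd_top_adj, ne_eq, Prod.mk.injEq]
  simp [f]
  grind

end PendantTree

theorem mainTheorem2 (p q : ℕ) (hpq : 2 * p ≤ q) :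
    ∃ (V : Type) (_ : Finite V) (G : SimpleGraph V),
      Nonempty (G ≃g completeBipartiteGraph (Fin (p + 2)) (Fin (q - p + 2))) ∧
      Nonempty (G.lineGraph ≃g
        (⊤ : SimpleGraph (Fin (p + 2))).boxProd (⊤ : SimpleGraph (Fin (q - p + 2)))) ∧
      PendantTree.connectivity 3 G = (p : ℕ∞) ∧
      PendantTree.connectivity 3 G.lineGraph = (q : ℕ∞) := by
  obtain ⟨e⟩ := PendantTree.nonempty_iso_lineGraph_completeBipartiteGraph
    (Fin (p + 2)) (Fin (q - p + 2))
  -- The assumption q ≥ 2p is what makes p + 2 the size of the smaller part.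
  refine ⟨_, inferInstance, completeBipartiteGraph (Fin (p + 2)) (Fin (q - p + 2)), ⟨.refl⟩,
    ⟨e.symm⟩, PendantTree.connectivity_three_completeBipartiteGraph (by omega), ?_⟩
  rw [PendantTree.connectivity_three_of_iso_boxProd_top e, Nat.add_sub_cancel' (by omega)]
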